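/- Let $\Delta=\{z\in\mathbb C:|z|<1\}$ be the open unit disc. A weight on an open set $U\subseteq\mathbb C$ is a continuous, bounded, strictly positive function $v\colon U\to\mathbb R$. Let $\mathcal H_v(U)$ be the space of all holomorphic $f\colon U\to\mathbb C$ with $\|f\|_v:=\sup_{z\in U}v(z)|f(z)|<\infty$, with norm $\|\cdot\|_v$, and let $\mathcal H_{v_o}(U)$ be the subspace of those $f$ for which $v(z)|f(z)|$ converges to $0$ as $z$ converges to the boundary of $U$; here a function $g$ on $U$ converges to $0$ on the boundary of $U$ if for every $\epsilon>0$ there is a compact $K\subset U$ with $|g(z)|<\epsilon$ for all $z\in U\setminus K$. For $z\in U$ let $\delta_z(f)=f(z)$. The weight $v$ is complete if, for every $z\in U$, the functional $v(z)\delta_z$ is an extreme point of the closed unit ball of the dual space $\mathcal H_{v_o}(U)'$. **Theorem.** Let $V$ be a connected open subset of $\mathbb C$, and let $v\colon\Delta\to\mathbb R$ and $w\colon V\to\mathbb R$ be weights, where $v$ is complete and converges to $0$ on the boundary of $\Delta$. Let $T\colon\mathcal H_{v_o}(\Delta)\to\mathcal H_{w_o}(V)$ be a linear isometry (not necessarily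 surjective). Then there are a surjective analytic function $\phi\colon V\to\Delta$ and a function $h_\phi\in\mathcal H_{w_o}(V)$ such that $$T(f)(z)=h_\phi(z)\,f(\phi(z))$$ for all $f\in\mathcal H_{v_o}(\Delta)$ and all $z\in V$. -/

import Mathlib

open TopologicalSpace

noncomputable section

namespace WeightedHolo

/-- The open unit disc of the complex plane. -/
def disc : Opens ℂ := ⟨Metric.ball (0 : ℂ) 1, Metric.isOpen_ball⟩

/-- A weight on an open set `U`: a continuous, bounded, strictly positive function on `U`. -/
structure Weight (U : Opens ℂ) where
  toFun : U → ℝ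
  continuous' : Continuous toFun
  pos' : ∀ z, 0 < toFun z
  bdd' : BddAbove (Set.range toFun)

instance {U : Opens ℂ} : CoeFun (Weight U) (fun _ => U → ℝ) := ⟨Weight.toFun⟩

variable {U : Opens ℂ}

/-- A function on the open set `U` is holomorphic if it is the restriction to `U` of a function
that is complex differentiable at every point of `U`. -/
def IsHolomorphic (f : U → ℂ) : Prop :=
  ∃ F : ℂ → ℂ, DifferentiableOn ℂ F (U : Set ℂ) ∧ ∀ z : U, F z = f z

/-- `g(z)` converges to `0` as `z` converges to the boundary of `U`: for every `ε > 0` there is a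
compact subset `K` of `U` with `|g| < ε` on `U \ K`. -/
def VanishesAtBoundary (g : U → ℝ) : Prop :=
  ∀ ε : ℝ, 0 < ε → ∃ K : Set ℂ, IsCompact K ∧ K ⊆ (U : Set ℂ) ∧
    ∀ z : U, (z : ℂ) ∉ K → |g z| < ε

theorem Weight.mul_norm_add_le (v : Weight U) (f g : U → ℂ) (z : U) :
    v z * ‖(f + g) z‖ ≤ v z * ‖f z‖ + v z * ‖g z‖ := by
  rw [← mul_add]
  exact mul_le_mul_of_nonneg_left (norm_add_le _ _) (v.pos' z).le

/-- The holomorphic functions `f` on `U` with `sup_{z ∈ U} v(z)|f(z)| < ∞`, as a vector space of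
functions on `U`. -/
def hvSubmodule (v : Weight U) : Submodule ℂ (U → ℂ) where
  carrier := {f | IsHolomorphic f ∧ BddAbove (Set.range fun z : U => v z * ‖f z‖)}
  zero_mem' := by
    refine ⟨⟨fun _ => 0, differentiableOn_const 0, fun _ => rfl⟩, 0, ?_⟩
    rintro _ ⟨z, rfl⟩
    simp
  add_mem' := by
    rintro f g ⟨⟨F, hF, hFf⟩, a, ha⟩ ⟨⟨G, hG, hGg⟩, b, hb⟩
    refine ⟨⟨F + G, hF.add hG, fun z => by simp [hFf, hGg]⟩, a + b, ?_⟩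
    rintro _ ⟨z, rfl⟩
    exact (v.mul_norm_add_le f g z).trans (add_le_add (ha ⟨z, rfl⟩) (hb ⟨z, rfl⟩))
  smul_mem' := by
    rintro c f ⟨⟨F, hF, hFf⟩, a, ha⟩
    refine ⟨⟨c • F, hF.const_smul c, fun z => by simp [hFf]⟩, ‖c‖ * a, ?_⟩
    rintro _ ⟨z, rfl⟩
    have h := mul_le_mul_of_nonneg_left (ha ⟨z, rfl⟩) (norm_nonneg c)
    simp only [Pi.smul_apply, norm_smul] at h ⊢
    linarith

/-- The space `H_v(U)`. This is a type of its own so that its topology is the one given by the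
weighted sup-norm and not the topology of pointwise convergence. -/
def Hv (v : Weight U) : Type := hvSubmodule v

variable {v : Weight U}

instance : AddCommGroup (Hv v) := inferInstanceAs (AddCommGroup (hvSubmodule v))

instance : Module ℂ (Hv v) := inferInstanceAs (Module ℂ (hvSubmodule v))

/-- The function on `U` that an element of `H_v(U)` is. -/
instance : CoeFun (Hv v) (fun _ => U → ℂ) := ⟨fun f => f.1⟩

theorem Hv.ext {f g : Hv v} (h : ∀ z, f z = g z) : f = g := Subtype.ext (funext h)

theorem Hv.zero_apply (z : U) : (0 : Hv v) z = 0 := rfl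

theorem Hv.add_apply (f g : Hv v) (z : U) : (f + g) z = f z + g z := rfl

theorem Hv.neg_apply (f : Hv v) (z : U) : (-f) z = -f z := rfl

theorem Hv.smul_apply (c : ℂ) (f : Hv v) (z : U) : (c • f) z = c * f z := rfl

theorem Hv.isHolomorphic (f : Hv v) : IsHolomorphic (f : U → ℂ) := f.2.1

theorem Hv.bddAbove (f : Hv v) : BddAbove (Set.range fun z : U => v z * ‖f z‖) := f.2.2

/-- The norm `‖f‖_v = sup_{z ∈ U} v(z)|f(z)|`. -/
instance : Norm (Hv v) := ⟨fun f => ⨆ z : U, v z * ‖f z‖⟩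

theorem Hv.norm_def (f : Hv v) : ‖f‖ = ⨆ z : U, v z * ‖f z‖ := rfl

theorem Hv.le_norm (f : Hv v) (z : U) : v z * ‖f z‖ ≤ ‖f‖ := le_ciSup f.bddAbove z

theorem Hv.norm_nonneg' (f : Hv v) : 0 ≤ ‖f‖ :=
  Real.iSup_nonneg fun z => mul_nonneg (v.pos' z).le (norm_nonneg _)

theorem Hv.norm_le {f : Hv v} {C : ℝ} (hC : 0 ≤ C) (h : ∀ z, v z * ‖f z‖ ≤ C) : ‖f‖ ≤ C :=
  Real.iSup_le h hC

instance : NormedAddCommGroup (Hv v) :=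
  AddGroupNorm.toNormedAddCommGroup
    { toFun := fun f => ‖f‖
      map_zero' := le_antisymm
        (Hv.norm_le le_rfl fun z => by simp [Hv.zero_apply]) (Hv.norm_nonneg' _)
      add_le' := fun f g => Hv.norm_le (add_nonneg f.norm_nonneg' g.norm_nonneg') fun z =>
        (v.mul_norm_add_le f g z).trans (add_le_add (f.le_norm z) (g.le_norm z))
      neg' := fun f => by simp only [Hv.norm_def, Hv.neg_apply, norm_neg]
      eq_zero_of_map_eq_zero' := fun f hf => Hv.ext fun z => by
        have h1 : v z * ‖f z‖ ≤ 0 := (f.le_norm z).trans (le_of_eq hf)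
        have h2 : ‖f z‖ ≤ 0 := nonpos_of_mul_nonpos_right h1 (v.pos' z)
        exact norm_le_zero_iff.1 h2 }

instance : NormedSpace ℂ (Hv v) where
  norm_smul_le c f := Hv.norm_le (mul_nonneg (norm_nonneg c) f.norm_nonneg') fun z => by
    have h := mul_le_mul_of_nonneg_left (f.le_norm z) (norm_nonneg c)
    rw [Hv.smul_apply, norm_mul]
    linarith

/-- The subspace `H_{v_o}(U)` of those `f` in `H_v(U)` for which `v(z)|f(z)|` converges to `0` as
`z` converges to the boundary of `U`; its norm is the restriction of `‖·‖_v`. -/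
def Hvo (v : Weight U) : Submodule ℂ (Hv v) where
  carrier := {f | VanishesAtBoundary fun z : U => v z * ‖f z‖}
  zero_mem' := fun ε hε => ⟨∅, isCompact_empty, Set.empty_subset _, fun z _ => by
    simpa [Hv.zero_apply] using hε⟩
  add_mem' := by
    intro f g hf hg ε hε
    obtain ⟨K, hK, hKU, hKf⟩ := hf (ε / 2) (half_pos hε)
    obtain ⟨L, hL, hLU, hLg⟩ := hg (ε / 2) (half_pos hε)
    refine ⟨K ∪ L, hK.union hL, Set.union_subset hKU hLU, fun z hz => ?_⟩
    have h1 := (abs_lt.1 (hKf z fun h => hz (Or.inl h))).2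
    have h2 := (abs_lt.1 (hLg z fun h => hz (Or.inr h))).2
    have h3 : v z * ‖(f + g) z‖ ≤ v z * ‖f z‖ + v z * ‖g z‖ := v.mul_norm_add_le f g z
    rw [abs_of_nonneg (mul_nonneg (v.pos' z).le (norm_nonneg _))]
    linarith
  smul_mem' := by
    intro c f hf ε hε
    have hc : 0 < ‖c‖ + 1 := by positivity
    obtain ⟨K, hK, hKU, hKf⟩ := hf (ε / (‖c‖ + 1)) (div_pos hε hc)
    refine ⟨K, hK, hKU, fun z hz => ?_⟩
    have h1 := (lt_div_iff₀ hc).1 (abs_lt.1 (hKf z hz)).2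
    have h0 : 0 ≤ v z * ‖f z‖ := mul_nonneg (v.pos' z).le (norm_nonneg _)
    rw [abs_of_nonneg (mul_nonneg (v.pos' z).le (norm_nonneg _)), Hv.smul_apply, norm_mul]
    nlinarith

/-- The evaluation functional `δ_z : f ↦ f(z)` in the dual of `H_{v_o}(U)`. -/
def evalAt (v : Weight U) (z : U) : StrongDual ℂ (Hvo v) :=
  LinearMap.mkContinuous
    { toFun := fun f => (f : Hv v) z
      map_add' := fun _ _ => rfl
      map_smul' := fun _ _ => rfl } (v z)⁻¹ fun f => by
    have h := (f : Hv v).le_norm z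
    rw [inv_mul_eq_div, le_div_iff₀ (v.pos' z), mul_comm]
    exact h

/-- The `v`-boundary of `U`: the set of all `z ∈ U` such that `v(z)δ_z` is an extreme point of the
closed unit ball of the dual of `H_{v_o}(U)`. -/
def vBoundary (v : Weight U) : Set U :=
  {z | ((v z : ℝ) : ℂ) • evalAt v z ∈
    Set.extremePoints ℝ (Metric.closedBall (0 : StrongDual ℂ (Hvo v)) 1)}

/-- A weight on `U` is complete if its `v`-boundary is all of `U`. -/
def Weight.IsComplete (v : Weight U) : Prop := vBoundary v = Set.univ

end WeightedHolo

end

/-! The functionals `c · w(ζ) δ_ζ ∘ T`, with `‖c‖ ≤ 1` and `ζ` in the one-point compactification of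
`V` (where infinity gives `0`), form a weak-* compact set, since each `w · T f` vanishes at the
boundary. The set is norming because `T` is an isometry, so by Milman's theorem it contains every
extreme point of the dual unit ball, in particular every `v(z) δ_z`. Comparing with the value at the
constant `1` gives a map `σ` from the disc to `V` with `T f (σ z) = T 1 (σ z) · f z` and `T 1 (σ z)
≠ 0`.

No regularity of `σ` is needed: it is injective, so its range is uncountable, and identities between
holomorphic functions that hold on the range hold on `V`. Thus `(T z)^(n+1) = (T 1)^n · T
(z^(n+1))`; as the norms of the monomials are bounded, `|T z| ≤ |T 1|`, and `φ = T z / T 1` extends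
holomorphically to `V`. It inverts `σ` on the left, hence is onto the disc, and `T f = T 1 · (f ∘
φ)` spreads from the range of `σ` to `V`. -/

/-! ### Convexity: Milman's theorem and norming sets -/

open Set Filter Topology in
theorem isCompact_convexHull_union {E : Type*} [AddCommGroup E] [Module ℝ E] [TopologicalSpace E]
    [IsTopologicalAddGroup E] [ContinuousSMul ℝ E] {A B : Set E}
    (hA : IsCompact (convexHull ℝ A)) (hB : IsCompact (convexHull ℝ B)) :
    IsCompact (convexHull ℝ (A ∪ B)) := by
  rcases A.eq_empty_or_nonempty with rfl | hA0
  · simpa using hB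
  rcases B.eq_empty_or_nonempty with rfl | hB0
  · simpa using hA
  have h : convexHull ℝ (A ∪ B) = (fun p : (E × E) × ℝ => (1 - p.2) • p.1.1 + p.2 • p.1.2) ''
      ((convexHull ℝ A ×ˢ convexHull ℝ B) ×ˢ Icc (0 : ℝ) 1) := by
    rw [convexHull_union hA0 hB0]
    ext x
    simp only [mem_convexJoin, segment_eq_image, mem_image, mem_prod, Prod.exists]
    constructor
    · rintro ⟨a, ha, b, hb, t, ht, rfl⟩
      exact ⟨a, b, t, ⟨⟨ha, hb⟩, ht⟩, rfl⟩
    · rintro ⟨a, b, t, ⟨⟨ha, hb⟩, ht⟩, rfl⟩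
      exact ⟨a, ha, b, hb, t, ht, rfl⟩
  rw [h]
  exact ((hA.prod hB).prod isCompact_Icc).image (by fun_prop)

open Set Filter Topology in
/-- **Milman's theorem**: if the closed convex hull of a compact set `K` is compact, then its
extreme points lie in `K`. -/
theorem extremePoints_closure_convexHull_subset {E : Type*} [AddCommGroup E] [Module ℝ E]
    [TopologicalSpace E] [IsTopologicalAddGroup E] [ContinuousSMul ℝ E] [LocallyConvexSpace ℝ E]
    [T2Space E] {K : Set E} (hK : IsCompact K) (hC : IsCompact (closure (convexHull ℝ K))) :
    (closure (convexHull ℝ K)).extremePoints ℝ ⊆ K := by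
  intro x hx
  by_contra hxK
  set C := closure (convexHull ℝ K) with hCdef
  have hCconv : Convex ℝ C := (convex_convexHull ℝ K).closure
  have hKC : K ⊆ C := (subset_convexHull ℝ K).trans subset_closure
  -- Cutting `C` by a half-space that contains `y` in its interior and misses `x`.
  have hsep : ∀ y ∈ K, ∃ A : Set E, A ∈ 𝓝[K] y ∧ IsCompact A ∧ Convex ℝ A ∧ A ⊆ C ∧ x ∉ A := by
    intro y hy
    have hyx : y ≠ x := fun h => hxK (h ▸ hy)
    obtain ⟨f, hf⟩ := geometric_hahn_banach_point_point hyx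
    obtain ⟨c, hc1, hc2⟩ := exists_between hf
    refine ⟨C ∩ {z | f z ≤ c}, ?_, hC.inter_right (isClosed_le f.continuous continuous_const),
      hCconv.inter (convex_halfSpace_le f.toLinearMap.isLinear c), inter_subset_left,
      fun h => absurd h.2 (not_le.2 hc2)⟩
    refine inter_mem (mem_of_superset self_mem_nhdsWithin hKC) (mem_nhdsWithin_of_mem_nhds ?_)
    exact mem_of_superset ((isOpen_lt f.continuous continuous_const).mem_nhds hc1)
      fun z hz => (show f z < c from hz).le
  choose! A hA1 hA2 hA3 hA4 hA5 using hsep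
  obtain ⟨t, ht, htK⟩ := hK.elim_nhdsWithin_subcover A hA1
  have hcomp : ∀ s : Finset E, (∀ y ∈ s, y ∈ K) → IsCompact (convexHull ℝ (⋃ y ∈ s, A y)) := by
    classical
    intro s
    induction s using Finset.induction_on with
    | empty => intro; simp
    | insert a s _ ih =>
      intro h
      rw [Finset.set_biUnion_insert]
      refine isCompact_convexHull_union ?_ (ih fun y hy => h y (Finset.mem_insert_of_mem hy))
      rw [(hA3 a (h a (Finset.mem_insert_self _ _))).convexHull_eq]
      exact hA2 a (h a (Finset.mem_insert_self _ _))
  -- The hull of finitely many slices is already compact, so no closure is needed, and an extreme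
  -- point of a plain convex hull lies in one of the slices.
  have heq : convexHull ℝ (⋃ y ∈ t, A y) = C := by
    apply Subset.antisymm
    · exact convexHull_min (iUnion₂_subset fun y hy => hA4 y (ht y hy)) hCconv
    · exact closure_minimal (convexHull_mono htK) (hcomp t ht).isClosed
  rw [← heq] at hx
  obtain ⟨y, hy, hxy⟩ := mem_iUnion₂.1 (extremePoints_convexHull_subset hx)
  exact hA5 y (ht y hy) hxy

open Set in
/-- A weak-* compact norming subset of the dual unit ball contains all extreme points of the
ball. -/
theorem toWeakDual_mem_of_mem_extremePoints {𝕜 X : Type*} [RCLike 𝕜] [NormedAddCommGroup X]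
    [NormedSpace 𝕜 X]
    {K : Set (WeakDual 𝕜 X)} (hK : IsCompact K) (hKb : ∀ k ∈ K, ∀ x, ‖k x‖ ≤ ‖x‖)
    (hKn : ∀ (x : X) (u : ℝ), (∀ k ∈ K, RCLike.re (k x) ≤ u) → ‖x‖ ≤ u) {L : StrongDual 𝕜 X}
    (hL : L ∈ (Metric.closedBall (0 : StrongDual 𝕜 X) 1).extremePoints ℝ) :
    StrongDual.toWeakDual L ∈ K := by
  set B : Set (WeakDual 𝕜 X) := WeakDual.toStrongDual ⁻¹' Metric.closedBall (0 : StrongDual 𝕜 X) 1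
  have hBc : IsCompact B := WeakDual.isCompact_closedBall 0 1
  have hB : ∀ k : WeakDual 𝕜 X, k ∈ B ↔ ∀ x, ‖k x‖ ≤ ‖x‖ := by
    intro k
    constructor
    · intro h x
      have h1 : ‖WeakDual.toStrongDual k‖ ≤ 1 := by simpa [B] using h
      simpa using (WeakDual.toStrongDual k).le_of_opNorm_le h1 x
    · intro h
      have h1 : ‖WeakDual.toStrongDual k‖ ≤ 1 :=
        ContinuousLinearMap.opNorm_le_bound _ zero_le_one fun x => by simpa using h x
      simpa [B] using h1
  have : LocallyConvexSpace ℝ (WeakDual 𝕜 X) :=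
    inferInstanceAs (LocallyConvexSpace ℝ (WeakBilin (topDualPairing 𝕜 X)))
  have : IsScalarTower ℝ 𝕜 (WeakDual 𝕜 X) :=
    inferInstanceAs (IsScalarTower ℝ 𝕜 (X →L[𝕜] 𝕜))
  have hBconv : Convex ℝ B := by
    intro k hk l hl a b ha hb hab
    rw [hB] at *
    intro x
    calc ‖a • k x + b • l x‖ ≤ ‖a • k x‖ + ‖b • l x‖ := norm_add_le _ _
      _ = a * ‖k x‖ + b * ‖l x‖ := by
        rw [norm_smul, norm_smul, Real.norm_of_nonneg ha, Real.norm_of_nonneg hb]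
      _ ≤ a * ‖x‖ + b * ‖x‖ := by gcongr <;> simp_all
      _ = ‖x‖ := by rw [← add_mul, hab, one_mul]
  have hCB : closure (convexHull ℝ K) ⊆ B :=
    closure_minimal (convexHull_min (fun k hk => (hB k).2 (hKb k hk)) hBconv) hBc.isClosed
  have hBC : B ⊆ closure (convexHull ℝ K) := by
    intro k hk
    by_contra hkC
    obtain ⟨F, u, hF, hFk⟩ := RCLike.geometric_hahn_banach_closed_point (𝕜 := 𝕜)
      (convex_convexHull ℝ K).closure isClosed_closure hkC
    -- A weak-* continuous functional is evaluation at a vector, to which the norming hypothesis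
    -- applies.
    obtain ⟨x, rfl⟩ := LinearMap.dualEmbedding_surjective (topDualPairing 𝕜 X) F
    have h1 := hKn x u fun l hl => (hF l (subset_closure (subset_convexHull ℝ K hl))).le
    have h2 : u < RCLike.re (k x) := hFk
    exact absurd (((RCLike.re_le_norm _).trans ((hB k).1 hk x)).trans h1) (not_le.2 h2)
  have hEq : closure (convexHull ℝ K) = B := hCB.antisymm hBC
  refine extremePoints_closure_convexHull_subset hK (hEq ▸ hBc) ?_
  rw [hEq]
  exact hL

/-! ### Complex analysis: identity theorem and removable singularities -/

open Set Filter Topology in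
/-- The identity theorem for holomorphic functions that agree on an uncountable set. -/
theorem DifferentiableOn.eqOn_of_not_countable {U S : Set ℂ} {f g : ℂ → ℂ} (hU : IsOpen U)
    (hUc : IsPreconnected U) (hf : DifferentiableOn ℂ f U) (hg : DifferentiableOn ℂ g U)
    (hSU : S ⊆ U) (hS : ¬ S.Countable) (hfg : EqOn f g S) : EqOn f g U := by
  by_contra hne
  -- An accumulation point of `S` in `S` would force `f = g` on `U`; but a discrete subset of the
  -- plane is Lindelöf, hence countable.
  have hd : DiscreteTopology S := by
    rw [discreteTopology_subtype_iff]
    intro x hx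
    by_contra hbot
    refine hne ((hf.analyticOnNhd hU).eqOn_of_preconnected_of_frequently_eq
      (hg.analyticOnNhd hU) hUc (hSU hx) fun hev => hbot ?_)
    rw [← Filter.empty_mem_iff_bot]
    filter_upwards [mem_inf_of_left hev, mem_inf_of_right (mem_principal_self S)] with z h1 h2
    exact h1 (hfg h2)
  exact hS (countable_coe_iff.1 (countable_of_Lindelof_of_discrete (X := S)))

open Set Filter Topology in
/-- A quotient of holomorphic functions that is bounded by `1` extends holomorphically across the
zeros of the denominator. -/
theorem exists_differentiableOn_mul_eq {U : Set ℂ} (hU : IsOpen U) (hUc : IsPreconnected U)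
    {g k : ℂ → ℂ} (hg : DifferentiableOn ℂ g U) (hk : DifferentiableOn ℂ k U)
    (hg0 : ∃ z ∈ U, g z ≠ 0) (hkg : ∀ z ∈ U, ‖k z‖ ≤ ‖g z‖) :
    ∃ φ : ℂ → ℂ, DifferentiableOn ℂ φ U ∧ ∀ z ∈ U, ‖φ z‖ ≤ 1 ∧ k z = g z * φ z := by
  set q : ℂ → ℂ := fun z => k z / g z with hq
  have hq1 : ∀ z ∈ U, ‖q z‖ ≤ 1 := fun z hz => by
    rw [hq, norm_div]
    exact div_le_one_of_le₀ (hkg z hz) (norm_nonneg _)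
  have hqd : ∀ z ∈ U, g z ≠ 0 → DifferentiableAt ℂ q z := fun z hz hgz =>
    (hk.differentiableAt (hU.mem_nhds hz)).div (hg.differentiableAt (hU.mem_nhds hz)) hgz
  have hne : ∀ c ∈ U, ∀ᶠ z in 𝓝[≠] c, z ∈ U ∧ g z ≠ 0 := by
    intro c hc
    refine Filter.Eventually.and (mem_nhdsWithin_of_mem_nhds (hU.mem_nhds hc)) ?_
    rcases ((hg.analyticOnNhd hU) c hc).eventually_eq_zero_or_eventually_ne_zero with h | h
    · obtain ⟨z, hz, hgz⟩ := hg0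
      exact absurd ((hg.analyticOnNhd hU).eqOn_zero_of_preconnected_of_eventuallyEq_zero hUc hc h
        hz) hgz
    · exact h
  have hlim : ∀ c ∈ U, Tendsto q (𝓝[≠] c) (𝓝 (limUnder (𝓝[≠] c) q)) := fun c hc =>
    Complex.tendsto_limUnder_of_differentiable_on_punctured_nhds_of_bounded_under
      ((hne c hc).mono fun z hz => hqd z hz.1 hz.2)
      -- The bound is on `q z - q c`; where `g c = 0`, the default value `q c = 0` still has norm at
      -- most `1`.
      ⟨2, eventually_map.2 ((hne c hc).mono fun z hz =>
        (norm_sub_le _ _).trans (by linarith [hq1 z hz.1, hq1 c hc]))⟩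
  refine ⟨fun c => limUnder (𝓝[≠] c) q, fun c hc => ?_, fun c hc => ⟨?_, ?_⟩⟩
  · have hs : {z | z ≠ c → z ∈ U ∧ g z ≠ 0} ∈ 𝓝 c := eventually_nhdsWithin_iff.1 (hne c hc)
    have hup := (Complex.differentiableOn_update_limUnder_of_bddAbove hs
      (fun z hz => (hqd z (hz.1 hz.2).1 (hz.1 hz.2).2).differentiableWithinAt)
      ⟨1, by rintro _ ⟨z, hz, rfl⟩; exact hq1 z (hz.1 hz.2).1⟩).differentiableAt hs
    refine (hup.congr_of_eventuallyEq ?_).differentiableWithinAt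
    filter_upwards [hs] with z hz
    rcases eq_or_ne z c with rfl | hzc
    · simp
    · rw [Function.update_of_ne hzc]
      exact ((hqd z (hz hzc).1 (hz hzc).2).continuousAt.tendsto.mono_left
        nhdsWithin_le_nhds).limUnder_eq
  · exact le_of_tendsto (hlim c hc).norm ((hne c hc).mono fun z hz => hq1 z hz.1)
  · have hkc := (hk.differentiableAt (hU.mem_nhds hc)).continuousAt.tendsto.mono_left
      (nhdsWithin_le_nhds (s := {c}ᶜ))
    have hgc := (hg.differentiableAt (hU.mem_nhds hc)).continuousAt.tendsto.mono_left
      (nhdsWithin_le_nhds (s := {c}ᶜ))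
    refine tendsto_nhds_unique hkc ((hgc.mul (hlim c hc)).congr' ?_)
    filter_upwards [hne c hc] with z hz
    exact mul_div_cancel₀ _ hz.2

/-! ### Weighted point evaluations and extreme points -/

namespace WeightedHolo

variable {U V : TopologicalSpace.Opens ℂ} {v : Weight U} {w : Weight V}

open Filter Topology in
theorem VanishesAtBoundary.tendsto_cocompact {g : U → ℝ} (hg : VanishesAtBoundary g) :
    Tendsto g (cocompact U) (𝓝 0) := by
  rw [Metric.tendsto_nhds]
  intro ε hε
  obtain ⟨K, hK, hKU, h⟩ := hg ε hε
  have hK' : IsCompact ((↑) ⁻¹' K : Set U) :=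
    Topology.IsInducing.subtypeVal.isCompact_preimage_iff (by simpa using hKU) |>.2 hK
  filter_upwards [hK'.compl_mem_cocompact] with z hz
  simpa using h z hz

theorem Hvo.continuous (f : Hvo v) : Continuous (f : Hv v) := by
  obtain ⟨F, hF, hFf⟩ := (f : Hv v).isHolomorphic
  have h := continuousOn_iff_continuous_domRestrict.1 hF.continuousOn
  exact h.congr fun z => hFf z

open Filter Topology in
/-- The function `v f` on `U`, extended by `0` to the point at infinity. -/
noncomputable def weightedExtension (f : Hvo v) : C(OnePoint U, ℂ) :=
  OnePoint.continuousMapMk ⟨fun z => (v z : ℂ) * (f : Hv v) z,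
    (Complex.continuous_ofReal.comp v.continuous').mul (Hvo.continuous f)⟩ 0 <| by
      rw [tendsto_zero_iff_norm_tendsto_zero]
      refine ((VanishesAtBoundary.tendsto_cocompact f.2).mono_left
        coclosedCompact_eq_cocompact.le).congr fun z => ?_
      simp [abs_of_pos (v.pos' z)]

theorem weightedExtension_infty (f : Hvo v) : weightedExtension f OnePoint.infty = 0 := rfl

theorem weightedExtension_coe (f : Hvo v) (z : U) :
    weightedExtension f z = (v z : ℂ) * (f : Hv v) z := rfl

theorem norm_weightedExtension_le (f : Hvo v) (p : OnePoint U) :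
    ‖weightedExtension f p‖ ≤ ‖f‖ := by
  induction p using OnePoint.rec with
  | infty => simp [weightedExtension_infty]
  | coe z =>
    rw [weightedExtension_coe, norm_mul, Complex.norm_real, Real.norm_of_nonneg (v.pos' z).le]
    exact (f : Hv v).le_norm z

/-- The multiple `c` of the functional `f ↦ w(p) (T f)(p)`, which is `0` at infinity. -/
noncomputable def weightedEval (T : Hvo v →ₗᵢ[ℂ] Hvo w) (p : OnePoint V × Metric.closedBall (0 : ℂ) 1) :
    WeakDual ℂ (Hvo v) :=
  StrongDual.toWeakDual <| LinearMap.mkContinuous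
    { toFun := fun f => p.2 * weightedExtension (T f) p.1
      map_add' := fun f g => by
        obtain ⟨p, c⟩ := p
        induction p using OnePoint.rec with
        | infty => simp [weightedExtension_infty]
        | coe z =>
          simp only [weightedExtension_coe, map_add, Submodule.coe_add, Hv.add_apply]
          ring
      map_smul' := fun a f => by
        obtain ⟨p, c⟩ := p
        induction p using OnePoint.rec with
        | infty => simp [weightedExtension_infty]
        | coe z =>
          simp only [weightedExtension_coe, map_smul, Submodule.coe_smul, Hv.smul_apply,
            RingHom.id_apply, smul_eq_mul]
          ring } 1 fun f => by
    have hc : ‖(p.2 : ℂ)‖ ≤ 1 := mem_closedBall_zero_iff.1 p.2.2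
    have h := norm_weightedExtension_le (T f) p.1
    rw [T.norm_map] at h
    simpa using mul_le_mul hc h (norm_nonneg _) zero_le_one

theorem weightedEval_apply (T : Hvo v →ₗᵢ[ℂ] Hvo w)
    (p : OnePoint V × Metric.closedBall (0 : ℂ) 1) (f : Hvo v) :
    weightedEval T p f = p.2 * weightedExtension (T f) p.1 := rfl

theorem continuous_weightedEval (T : Hvo v →ₗᵢ[ℂ] Hvo w) : Continuous (weightedEval T) :=
  WeakDual.continuous_of_continuous_eval fun f =>
    (continuous_subtype_val.comp continuous_snd).mul
      ((weightedExtension (T f)).continuous.comp continuous_fst)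

open ComplexConjugate in
/-- At a point `z` of the `v`-boundary of `U`, the functional `v(z) δ_z` is a multiple of the
pull-back under `T` of a point evaluation on `V`, or `0`. -/
theorem exists_weightedEval_eq (T : Hvo v →ₗᵢ[ℂ] Hvo w) {z : U} (hz : z ∈ vBoundary v) :
    ∃ p, ∀ f : Hvo v, weightedEval T p f = (v z : ℂ) * (f : Hv v) z := by
  have hbound : ∀ k ∈ Set.range (weightedEval T), ∀ f, ‖k f‖ ≤ ‖f‖ := by
    rintro _ ⟨p, rfl⟩ f
    have hc : ‖(p.2 : ℂ)‖ ≤ 1 := mem_closedBall_zero_iff.1 p.2.2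
    have h := norm_weightedExtension_le (T f) p.1
    rw [T.norm_map] at h
    simpa [weightedEval_apply] using mul_le_mul hc h (norm_nonneg _) zero_le_one
  have hnorming : ∀ (f : Hvo v) (u : ℝ),
      (∀ k ∈ Set.range (weightedEval T), (k f).re ≤ u) → ‖f‖ ≤ u := by
    intro f u hu
    rw [← T.norm_map]
    have hu0 : 0 ≤ u := by
      simpa [weightedEval_apply] using hu _ ⟨(OnePoint.infty, ⟨0, by simp⟩), rfl⟩
    refine Hv.norm_le hu0 fun ζ => ?_
    set a := (T f : Hv w) ζ
    change w ζ * ‖a‖ ≤ u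
    rcases eq_or_ne a 0 with ha | ha
    · simpa [ha] using hu0
    have ha' : (‖a‖ : ℂ) ≠ 0 := by simpa using ha
    -- This unimodular factor rotates `a` to `‖a‖`, so that the real part is the whole modulus.
    have h := hu _ ⟨((ζ : OnePoint V), ⟨conj a / ‖a‖, by simp [ha]⟩), rfl⟩
    have h2 : conj a / ‖a‖ * ((w ζ : ℂ) * a) = ((w ζ * ‖a‖ : ℝ) : ℂ) := by
      field_simp
      push_cast
      linear_combination (w ζ : ℂ) * Complex.conj_mul' a
    have h3 : weightedEval T ((ζ : OnePoint V), ⟨conj a / ‖a‖, by simp [ha]⟩) f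
      = ((w ζ * ‖a‖ : ℝ) : ℂ) := h2
    rw [h3] at h
    simpa using h
  obtain ⟨p, hp⟩ := toWeakDual_mem_of_mem_extremePoints (𝕜 := ℂ)
    (isCompact_range (continuous_weightedEval T)) hbound hnorming hz
  exact ⟨p, fun f => by rw [hp]; rfl⟩

/-! ### Monomials and the points of `V` over the disc -/

/-- The monomial `z ^ n` as an element of `H_{v_o}(Δ)`, for a weight that vanishes at the
boundary. -/
def monomial {v : Weight disc} (hv0 : VanishesAtBoundary v.toFun) (n : ℕ) : Hvo v :=
  have hle : ∀ z : disc, v z * ‖(z : ℂ) ^ n‖ ≤ v z := fun z => by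
    have hz : ‖(z : ℂ)‖ < 1 := by simpa [disc] using z.2
    rw [norm_pow]
    exact mul_le_of_le_one_right (v.pos' z).le (pow_le_one₀ (norm_nonneg _) hz.le)
  ⟨⟨fun z => (z : ℂ) ^ n, ⟨fun z => z ^ n, (differentiable_pow n).differentiableOn, fun _ => rfl⟩,
    let ⟨C, hC⟩ := v.bdd'
    ⟨C, by rintro _ ⟨z, rfl⟩; exact (hle z).trans (hC ⟨z, rfl⟩)⟩⟩, fun ε hε => by
    obtain ⟨K, hK, hKU, h⟩ := hv0 ε hε
    refine ⟨K, hK, hKU, fun z hz => ?_⟩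
    rw [abs_of_nonneg (mul_nonneg (v.pos' z).le (norm_nonneg _))]
    exact (hle z).trans_lt ((le_abs_self _).trans_lt (h z hz))⟩

theorem monomial_apply {v : Weight disc} (hv0 : VanishesAtBoundary v.toFun) (n : ℕ) (z : disc) :
    (monomial hv0 n : Hv v) z = (z : ℂ) ^ n := rfl

/-- Uniformity in `n` is the point: it rules out geometric growth of `T (z^n)` at a point of `V`. -/
theorem exists_norm_monomial_le {v : Weight disc} (hv0 : VanishesAtBoundary v.toFun) :
    ∃ C : ℝ, ∀ n, ‖monomial hv0 n‖ ≤ C := by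
  obtain ⟨C, hC⟩ := v.bdd'
  have hC0 : 0 ≤ C :=
    (v.pos' ⟨0, by simp [disc]⟩).le.trans (hC ⟨⟨0, by simp [disc]⟩, rfl⟩)
  refine ⟨C, fun n => Hv.norm_le hC0 fun z => ?_⟩
  have hz : ‖(z : ℂ)‖ < 1 := by simpa [disc] using z.2
  change v z * ‖(z : ℂ) ^ n‖ ≤ C
  rw [norm_pow]
  exact (mul_le_of_le_one_right (v.pos' z).le (pow_le_one₀ (norm_nonneg _) hz.le)).trans
    (hC ⟨z, rfl⟩)

/-- Every point `z` of the `v`-boundary comes from a point `ζ` of `V` at which `T f` is a nonzero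
multiple of `f(z)`. -/
theorem exists_map_apply_eq {v : Weight disc} (hv0 : VanishesAtBoundary v.toFun)
    (T : Hvo v →ₗᵢ[ℂ] Hvo w) {z : disc} (hz : z ∈ vBoundary v) :
    ∃ ζ : V, (T (monomial hv0 0) : Hv w) ζ ≠ 0 ∧
      ∀ f : Hvo v, (T f : Hv w) ζ = (T (monomial hv0 0) : Hv w) ζ * (f : Hv v) z := by
  obtain ⟨⟨p, c⟩, hp⟩ := exists_weightedEval_eq T hz
  have hvz : (v z : ℂ) ≠ 0 := Complex.ofReal_ne_zero.2 (v.pos' z).ne'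
  have h1 := hp (monomial hv0 0)
  rw [monomial_apply, pow_zero, mul_one] at h1
  induction p using OnePoint.rec with
  | infty =>
    rw [weightedEval_apply, weightedExtension_infty, mul_zero] at h1
    exact absurd h1.symm hvz
  | coe ζ =>
    rw [weightedEval_apply, weightedExtension_coe] at h1
    have hne : (c : ℂ) * (w ζ * (T (monomial hv0 0) : Hv w) ζ) ≠ 0 := h1 ▸ hvz
    have hc := left_ne_zero_of_mul hne
    have hw := left_ne_zero_of_mul (right_ne_zero_of_mul hne)
    refine ⟨ζ, right_ne_zero_of_mul (right_ne_zero_of_mul hne), fun f => ?_⟩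
    have hf := hp f
    rw [weightedEval_apply, weightedExtension_coe, ← h1] at hf
    refine mul_left_cancel₀ hw (mul_left_cancel₀ hc (hf.trans ?_))
    ring

end WeightedHolo

/-! ### The composition formula -/

theorem theorem2p3 (V : TopologicalSpace.Opens ℂ) (hV : IsPreconnected (V : Set ℂ))
    (v : WeightedHolo.Weight WeightedHolo.disc) (w : WeightedHolo.Weight V)
    (hv : v.IsComplete) (hv0 : WeightedHolo.VanishesAtBoundary v.toFun)
    (T : WeightedHolo.Hvo v →ₗᵢ[ℂ] WeightedHolo.Hvo w) :
    ∃ φ : V → WeightedHolo.disc,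
      WeightedHolo.IsHolomorphic (fun z : V => (φ z : ℂ)) ∧ Function.Surjective φ ∧
        ∃ h : WeightedHolo.Hvo w, ∀ (f : WeightedHolo.Hvo v) (z : V),
          (T f : WeightedHolo.Hv w) z =
            (h : WeightedHolo.Hv w) z * (f : WeightedHolo.Hv v) (φ z) := by
  have hb := fun z : WeightedHolo.disc =>
    WeightedHolo.exists_map_apply_eq hv0 T (z := z) (hv ▸ Set.mem_univ z)
  choose σ hσ0 hσ using hb
  set m := WeightedHolo.monomial hv0
  choose G hGd hG using fun f : WeightedHolo.Hvo v => (T f : WeightedHolo.Hv w).isHolomorphic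
  have hσ0' : ∀ z, G (m 0) (σ z) ≠ 0 := fun z => by rw [hG]; exact hσ0 z
  have hσ' : ∀ z f, G f (σ z) = G (m 0) (σ z) * (f : WeightedHolo.Hv v) z := fun z f => by
    rw [hG, hG]; exact hσ z f
  have hσm : ∀ z n, G (m n) (σ z) = G (m 0) (σ z) * (z : ℂ) ^ n := fun z n => hσ' z (m n)
  have hS : ¬ (Set.range fun z => (σ z : ℂ)).Countable := by
    intro hc
    have hinj : Function.Injective fun z => (σ z : ℂ) := by
      intro a b hab
      have h1 := hσm a 1
      have h2 := hσm b 1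
      simp only at hab
      rw [hab] at h1
      rw [pow_one] at h1 h2
      exact Subtype.ext (mul_left_cancel₀ (hσ0' b) (h1.symm.trans h2))
    have hd : (Metric.ball (0 : ℂ) 1).Countable :=
      Set.countable_coe_iff.1 <| Set.countable_univ_iff.1 <|
        Set.countable_of_injective_of_countable_image hinj.injOn (Set.image_univ ▸ hc)
    have h := hd.dense_compl ℝ
    rw [← interior_eq_empty_iff_dense_compl, Metric.isOpen_ball.interior_eq] at h
    norm_num at h
  have hSV : (Set.range fun z => (σ z : ℂ)) ⊆ V := by
    rintro _ ⟨z, rfl⟩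
    exact (σ z).2
  have hid : ∀ {f g : ℂ → ℂ}, DifferentiableOn ℂ f V → DifferentiableOn ℂ g V →
      (∀ z, f (σ z) = g (σ z)) → Set.EqOn f g V := fun hf hg h =>
    hf.eqOn_of_not_countable V.isOpen hV hg hSV hS (by rintro _ ⟨z, rfl⟩; exact h z)
  have hpow : ∀ n, Set.EqOn (fun ζ => G (m 1) ζ ^ (n + 1))
      (fun ζ => G (m 0) ζ ^ n * G (m (n + 1)) ζ) V := fun n =>
    hid ((hGd _).pow _) (((hGd _).pow _).mul (hGd _)) fun z => by
      rw [hσm z 1, hσm z (n + 1)]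
      ring
  obtain ⟨C, hC⟩ := WeightedHolo.exists_norm_monomial_le hv0
  have hle : ∀ ζ ∈ (V : Set ℂ), ‖G (m 1) ζ‖ ≤ ‖G (m 0) ζ‖ := by
    intro ζ hζ
    rcases eq_or_ne (G (m 0) ζ) 0 with h0 | h0
    -- At a zero of `T 1`, the relation `(T z)^2 = T 1 · T (z^2)` makes `T z` vanish too.
    · have h := hpow 1 hζ
      simp only [h0] at h
      have h' : G (m 1) ζ = 0 := by simpa using h
      simp [h', h0]
    by_contra! hlt
    have hpos : 0 < ‖G (m 0) ζ‖ := norm_pos_iff.2 h0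
    have hw := w.pos' ⟨ζ, hζ⟩
    -- Chosen so that `w |T 1| |T z / T 1|^n`, which equals `w |T (z^n)|` at `ζ`, exceeds the bound
    -- `C`.
    obtain ⟨n, hn⟩ := pow_unbounded_of_one_lt (C / (w ⟨ζ, hζ⟩ * ‖G (m 0) ζ‖))
      ((one_lt_div hpos).2 hlt)
    have hm : w ⟨ζ, hζ⟩ * ‖G (m n) ζ‖ ≤ C := by
      have h := (T (m n) : WeightedHolo.Hv w).le_norm ⟨ζ, hζ⟩
      rw [← hG] at h
      exact h.trans ((T.norm_map (m n)).le.trans (hC n))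
    have hq : G (m n) ζ = G (m 0) ζ * (G (m 1) ζ / G (m 0) ζ) ^ n := by
      rcases n with _ | n
      · simp
      · have h := hpow n hζ
        simp only at h
        rw [div_pow, h]
        field_simp
        ring
    rw [hq, norm_mul, norm_pow, norm_div, ← mul_assoc] at hm
    rw [div_lt_iff₀ (mul_pos hw hpos)] at hn
    linarith
  have h00 : (0 : ℂ) ∈ Metric.ball (0 : ℂ) 1 := by simp
  obtain ⟨φ, hφd, hφ⟩ := exists_differentiableOn_mul_eq V.isOpen hV (hGd (m 0)) (hGd (m 1))
    ⟨σ ⟨0, h00⟩, (σ _).2, hσ0' _⟩ hle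
  have hφσ : ∀ z, φ (σ z) = z := fun z => by
    have h := (hφ (σ z) (σ z).2).2
    rw [hσm z 1, pow_one] at h
    exact (mul_left_cancel₀ (hσ0' z) h).symm
  have hφ1 : ∀ ζ ∈ (V : Set ℂ), φ ζ ∈ Metric.ball (0 : ℂ) 1 := by
    intro ζ hζ
    rw [mem_ball_zero_iff]
    refine lt_of_le_of_ne (hφ ζ hζ).1 fun h1 => ?_
    -- By the maximum principle `|φ|` would be `1` throughout `V`, whereas `φ (σ 0) = 0`.
    have h := Complex.norm_eqOn_of_isPreconnected_of_isMaxOn hV V.isOpen hφd hζ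
      (fun x hx => by simpa [h1] using (hφ x hx).1) (σ ⟨0, h00⟩).2
    simp [hφσ, h1] at h
  refine ⟨fun ζ => ⟨φ ζ, hφ1 ζ ζ.2⟩, ⟨φ, hφd, fun _ => rfl⟩,
    fun z => ⟨σ z, Subtype.ext (hφσ z)⟩, T (m 0), fun f ζ => ?_⟩
  obtain ⟨F, hFd, hF⟩ := (f : WeightedHolo.Hv v).isHolomorphic
  have h := hid (hGd f) ((hGd (m 0)).mul (hFd.comp hφd hφ1)) (fun z => by
    simp only [Pi.mul_apply, Function.comp_apply, hφσ, hF]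
    exact hσ' z f) ζ.2
  simp only [Pi.mul_apply, Function.comp_apply, hG] at h
  rw [h, ← hF]
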